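/- **Setting.** Let $I=\{1,\dots,n\}$ be the vertex set of a connected simple undirected graph $(I,E)$ with symmetric weights $\omega_{ij}=\omega_{ji}$, where $\omega_{ij}>0$ if $\{i,j\}\in E$ and $\omega_{ij}=0$ otherwise, and let $d_i=\sum_j\omega_{ij}\big/\sum_{k,j}\omega_{kj}$. For $x\in\mathbb R^n$ let $L(x)=D^{\mathsf T}\Lambda(x)D$ be the weighted Laplacian: the rows of $D\in\mathbb R^{|E|\times n}$ are indexed by the edges $(i,j)$, $i>j$, with entry $\sqrt{\omega_{ij}}$ in column $i$, $-\sqrt{\omega_{ij}}$ in column $j$ and $0$ elsewhere, and $\Lambda(x)$ is diagonal with entries $\tfrac12\big(\tfrac{x_i}{d_i}+\tfrac{x_j}{d_j}\big)$. Write $A^\dagger$ for the Moore–Penrose pseudo-inverse of a matrix $A$, and $\mathcal P_+(I)$ for the set of strictly positive probability vectors on $I$. Let $\Theta\subseteq\mathbb R^d$ be open or, more generally, a set at each point of which the derivative of a function on $\Theta$ is unique (i.e. the tangent cone of $\Theta$ at each of its points spans $\mathbb R^d$; for example a closed convex set with non-empty interior). Let $p:\Theta\to\mathcal P_+(I)$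 be $C^1$ with Jacobi matrix $J_\theta p(\theta)\in\mathbb R^{n\times d}$ of rank $d$ at every $\theta\in\Theta$. Put $$G_W(\theta)=J_\theta p(\theta)^{\mathsf T}L(p(\theta))^\dagger J_\theta p(\theta),\qquad g_W(a,b)=a^{\mathsf T}G_W(\theta)b,$$ $$d_W(\theta_0,\theta_1)^2=\inf\Big\{\int_0^1\dot\theta(t)^{\mathsf T}G_W(\theta(t))\dot\theta(t)\,dt\;:\;\theta\in C^1([0,1],\Theta),\ \theta(0)=\theta_0,\ \theta(1)=\theta_1\Big\}\in[0,\infty].$$ A *constant speed geodesic* from $\theta_0$ to $\theta_1$ is a map $t\in[0,1]\mapsto\theta_t\in\Theta$ with the given endpoints, $d_W(\theta_0,\theta_1)<\infty$, and $d_W(\theta_s,\theta_t)=|s-t|\,d_W(\theta_0,\theta_1)$ for all $s,t\in[0,1]$. Fix $q\in\mathcal P_+(I)$ and let $\operatorname{D}_{\operatorname{KL}}(p(\theta)\|q)=\sum_{i}p_i(\theta)\log\frac{p_i(\theta)}{q_i}$. For $\kappa\in\mathbb R$, write $\operatorname{Ric}(\Theta,I,p)\ge\kappa$ if for every constant speed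 geodesic $(\theta_t)_{t\in[0,1]}$ and all $t\in[0,1]$ $$\operatorname{D}_{\operatorname{KL}}(p(\theta_t)\|q)\le(1-t)\operatorname{D}_{\operatorname{KL}}(p(\theta_0)\|q)+t\operatorname{D}_{\operatorname{KL}}(p(\theta_1)\|q)-\tfrac{\kappa}{2}t(1-t)\,d_W(\theta_0,\theta_1)^2 .$$ Let $\operatorname{grad}_W\operatorname{D}_{\operatorname{KL}}(p(\theta)\|q)=G_W(\theta)^\dagger\nabla_\theta \operatorname{D}_{\operatorname{KL}}(p(\theta)\|q)$ and $$\mathcal I(p(\theta)\|q)=g_W\big(\operatorname{grad}_W\operatorname{D}_{\operatorname{KL}}(p(\theta)\|q),\operatorname{grad}_W\operatorname{D}_{\operatorname{KL}}(p(\theta)\|q)\big).$$ **Proposition.** Let $\theta^*\in\Theta$ minimize $\theta\mapsto\operatorname{D}_{\operatorname{KL}}(p(\theta)\|q)$ over $\Theta$, and suppose that every $\theta\in\Theta$ can be joined to $\theta^*$ by a constant speed geodesic. (i) (Log-Sobolev) If $\operatorname{Ric}(\Theta,I,p)\ge\kappa>0$, then for all $\theta\in\Theta$ $$\operatorname{D}_{\operatorname{KL}}(p(\theta)\|q)-\operatorname{D}_{\operatorname{KL}}(p(\theta^*)\|q)\le\frac1{2\kappa}\,\mathcal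 I(p(\theta)\|q).$$ (ii) (Talagrand) If $\operatorname{Ric}(\Theta,I,p)\ge\kappa>0$, then for all $\theta\in\Theta$ $$\frac{\kappa}{2}\,d_W(\theta,\theta^*)^2\le\operatorname{D}_{\operatorname{KL}}(p(\theta)\|q)-\operatorname{D}_{\operatorname{KL}}(p(\theta^*)\|q).$$ (iii) (HWI) If $\operatorname{Ric}(\Theta,I,p)\ge\kappa$ for some $\kappa\in\mathbb R$ (of any sign), then for all $\theta\in\Theta$ $$\operatorname{D}_{\operatorname{KL}}(p(\theta)\|q)-\operatorname{D}_{\operatorname{KL}}(p(\theta^*)\|q)\le\sqrt{\mathcal I(p(\theta)\|q)}\;d_W(\theta,\theta^*)-\frac{\kappa}{2}\,d_W(\theta,\theta^*)^2 .$$ -/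

import Mathlib

open Set Matrix
open scoped ENNReal

/-- The four Penrose equations for a square real matrix: `B` is the pseudo-inverse of `A`. -/
structure IsMoorePenrose {m : ℕ} (A B : Matrix (Fin m) (Fin m) ℝ) : Prop where
  mul_mul_left : A * B * A = A
  mul_mul_right : B * A * B = B
  symm_left : (A * B)ᵀ = A * B
  symm_right : (B * A)ᵀ = B * A

theorem IsMoorePenrose.unique {m : ℕ} {A B C : Matrix (Fin m) (Fin m) ℝ}
    (hB : IsMoorePenrose A B) (hC : IsMoorePenrose A C) : B = C := by
  have h1 : A * B = A * C := by
    calc A * B = (A * B)ᵀ := hB.symm_left.symm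
      _ = (A * C * (A * B))ᵀ := by rw [← mul_assoc, hC.mul_mul_left]
      _ = A * B * (A * C) := by rw [transpose_mul, hB.symm_left, hC.symm_left]
      _ = A * C := by rw [← mul_assoc, hB.mul_mul_left]
  have h2 : B * A = C * A := by
    calc B * A = (B * A)ᵀ := hB.symm_right.symm
      _ = (B * A * (C * A))ᵀ := by rw [mul_assoc B A, ← mul_assoc A C A, hC.mul_mul_left]
      _ = C * A * (B * A) := by rw [transpose_mul, hB.symm_right, hC.symm_right]
      _ = C * A := by rw [mul_assoc C A, ← mul_assoc A B A, hB.mul_mul_left]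
  calc B = B * A * B := hB.mul_mul_right.symm
    _ = C * (A * B) := by rw [h2, mul_assoc]
    _ = C := by rw [h1, ← mul_assoc, hC.mul_mul_right]

theorem exists_isMoorePenrose {m : ℕ} (A : Matrix (Fin m) (Fin m) ℝ) :
    ∃ B, IsMoorePenrose A B := by
  have hS : IsSelfAdjoint (Aᵀ * A) := by
    simp [IsSelfAdjoint, star_eq_conjTranspose]
  obtain ⟨S, hSdef⟩ : ∃ S, S = Aᵀ * A := ⟨_, rfl⟩
  rw [← hSdef] at hS
  have hc : ∀ f : ℝ → ℝ, ContinuousOn f (spectrum ℝ S) := fun f =>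
    (Matrix.finite_real_spectrum (A := S)).continuousOn f
  obtain ⟨T, hT⟩ : ∃ T : Matrix (Fin m) (Fin m) ℝ, T = cfc (fun x : ℝ => x⁻¹) S := ⟨_, rfl⟩
  have hid : S = cfc (fun x : ℝ => x) S := (cfc_id' ℝ S).symm
  have hTs : Tᵀ = T := by
    have : IsSelfAdjoint T := hT ▸ cfc_predicate _ _
    simpa [IsSelfAdjoint, star_eq_conjTranspose] using this
  have hSs : Sᵀ = S := by simpa [IsSelfAdjoint, star_eq_conjTranspose] using hS
  have hST : S * T = cfc (fun x : ℝ => x * x⁻¹) S := by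
    rw [cfc_mul (fun x : ℝ => x) (fun x : ℝ => x⁻¹) S (hc _) (hc _), ← hid, ← hT]
  have hTS : T * S = cfc (fun x : ℝ => x⁻¹ * x) S := by
    rw [cfc_mul (fun x : ℝ => x⁻¹) (fun x : ℝ => x) S (hc _) (hc _), ← hid, ← hT]
  have hcomm : T * S = S * T := by
    rw [hST, hTS]
    simp_rw [mul_comm]
  have hSTS : S * T * S = S := by
    have h : cfc (fun x : ℝ => x * x⁻¹ * x) S = S * T * S := by
      rw [cfc_mul (fun x : ℝ => x * x⁻¹) (fun x : ℝ => x) S (hc _) (hc _), ← hid, ← hST]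
    rw [← h]
    simp only [mul_inv_mul_cancel]
    exact hid.symm
  have hTST : T * S * T = T := by
    have h : cfc (fun x : ℝ => x⁻¹ * x * x⁻¹) S = T * S * T := by
      rw [cfc_mul (fun x : ℝ => x⁻¹ * x) (fun x : ℝ => x⁻¹) S (hc _) (hc _), ← hTS, ← hT]
    rw [← h, hT]
    congr 1
    funext x
    by_cases hx : x = 0
    · simp [hx]
    · field_simp
  have hATS : A * (T * S) = A := by
    have h0 : (A * (T * S) - A)ᵀ * (A * (T * S) - A) = 0 := by
      have e : (A * (T * S) - A)ᵀ = S * T * Aᵀ - Aᵀ := by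
        rw [transpose_sub, transpose_mul, transpose_mul, hTs, hSs]
      have e2 : Aᵀ * (A * (T * S) - A) = 0 := by
        rw [mul_sub, ← mul_assoc, ← hSdef, ← mul_assoc, hSTS, sub_self]
      rw [e, sub_mul, mul_assoc, e2]
      simp
    have h1 : (A * (T * S) - A)ᴴ * (A * (T * S) - A) = 0 := by
      simpa [conjTranspose_eq_transpose_of_trivial] using h0
    exact sub_eq_zero.1 (conjTranspose_mul_self_eq_zero.1 h1)
  refine ⟨T * Aᵀ, ?_, ?_, ?_, ?_⟩
  · rw [mul_assoc, mul_assoc T, ← hSdef, hATS]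
  · rw [mul_assoc T, ← hSdef, ← mul_assoc, hTST]
  · rw [transpose_mul, transpose_mul, transpose_transpose, hTs, mul_assoc]
  · rw [mul_assoc, ← hSdef, transpose_mul, hTs, hSs, hcomm]

/-- The Moore-Penrose pseudo-inverse of a square real matrix. -/
noncomputable def pinv {m : ℕ} (A : Matrix (Fin m) (Fin m) ℝ) : Matrix (Fin m) (Fin m) ℝ :=
  (exists_isMoorePenrose A).choose

theorem pinv_spec {m : ℕ} (A : Matrix (Fin m) (Fin m) ℝ) : IsMoorePenrose A (pinv A) :=
  (exists_isMoorePenrose A).choose_spec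

/-- A connected simple undirected graph on the sample space `{1, …, n}` with symmetric weights,
positive exactly on the edges. -/
structure WeightedGraph (n : ℕ) where
  graph : SimpleGraph (Fin n)
  connected : graph.Connected
  weight : Fin n → Fin n → ℝ
  weight_symm : ∀ i j, weight i j = weight j i
  weight_pos : ∀ i j, graph.Adj i j → 0 < weight i j
  weight_zero : ∀ i j, ¬ graph.Adj i j → weight i j = 0

namespace WeightedGraph

variable {n : ℕ} (G : WeightedGraph n)

/-- The normalized volume `d_i` of a node (weights vanish off the edges). -/
noncomputable def vol (i : Fin n) : ℝ :=
  (∑ j, G.weight i j) / ∑ k, ∑ j, G.weight k j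

/-- Undirected edges, each represented by the ordered pair `(i, j)` with `i > j`. -/
abbrev Edge : Type := {e : Fin n × Fin n // G.graph.Adj e.1 e.2 ∧ e.2 < e.1}

noncomputable instance : Fintype G.Edge := Fintype.ofFinite _

/-- The discrete gradient operator. -/
noncomputable def discreteGrad : Matrix G.Edge (Fin n) ℝ :=
  Matrix.of fun e k =>
    if k = e.1.1 then √(G.weight e.1.1 e.1.2)
    else if k = e.1.2 then -√(G.weight e.1.1 e.1.2)
    else 0

/-- The diagonal weight matrix `Λ(x)`. -/
noncomputable def edgeWeight (x : Fin n → ℝ) : Matrix G.Edge G.Edge ℝ :=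
  Matrix.diagonal fun e =>
    (1 / 2) * ((1 / G.vol e.1.1) * x e.1.1 + (1 / G.vol e.1.2) * x e.1.2)

/-- The weighted Laplacian matrix `L(x) = Dᵀ Λ(x) D`. -/
noncomputable def laplacian (x : Fin n → ℝ) : Matrix (Fin n) (Fin n) ℝ :=
  G.discreteGradᵀ * G.edgeWeight x * G.discreteGrad

end WeightedGraph

/-- The interior of the probability simplex: strictly positive probability vectors. -/
def posSimplex (n : ℕ) : Set (Fin n → ℝ) :=
  {x | (∀ i, 0 < x i) ∧ ∑ i, x i = 1}

/-- The Jacobi matrix `(∂ f_i / ∂ θ_j)` of `f : Θ → ℝⁿ` at `θ`, for `Θ ⊆ ℝᵈ`. If `Θ` is open this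
is the usual Jacobi matrix. -/
noncomputable def jacobian {n d : ℕ} (Θ : Set (Fin d → ℝ)) (f : (Fin d → ℝ) → Fin n → ℝ)
    (θ : Fin d → ℝ) : Matrix (Fin n) (Fin d) ℝ :=
  Matrix.of fun i j => fderivWithin ℝ f Θ θ (Pi.single j 1) i

/-- A statistical model `(Θ, I, p)`, `I = {1, …, n}`: a continuously differentiable parametrization
of strictly positive distributions whose Jacobi matrix has full rank `d` everywhere.
`UniqueDiffOn` says that derivatives at points of `Θ` are determined by values on `Θ`; it holds for
every open set and, e.g., for every convex set with non-empty interior. -/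
structure StatModel (n d : ℕ) where
  Θ : Set (Fin d → ℝ)
  p : (Fin d → ℝ) → Fin n → ℝ
  uniqueDiffOn : UniqueDiffOn ℝ Θ
  mem_posSimplex : ∀ θ ∈ Θ, p θ ∈ posSimplex n
  contDiffOn : ContDiffOn ℝ 1 p Θ
  rank_jacobian : ∀ θ ∈ Θ, (jacobian Θ p θ).rank = d

namespace StatModel

variable {n d : ℕ} (M : StatModel n d) (G : WeightedGraph n)

/-- The Wasserstein metric tensor `G_W(θ) = Jᵀ L(p(θ))† J` on parameter space. -/
noncomputable def metricW (θ : Fin d → ℝ) : Matrix (Fin d) (Fin d) ℝ :=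
  (jacobian M.Θ M.p θ)ᵀ * pinv (G.laplacian (M.p θ)) * jacobian M.Θ M.p θ

/-- The Riemannian inner product `g^W_θ(a, b) = aᵀ G_W(θ) b`. -/
noncomputable def innerW (θ a b : Fin d → ℝ) : ℝ :=
  a ⬝ᵥ (M.metricW G θ *ᵥ b)

/-- The curves of class `C¹([0,1], Θ)` from `θ₀` to `θ₁`. -/
def curves (θ₀ θ₁ : Fin d → ℝ) : Set (ℝ → Fin d → ℝ) :=
  {γ | ContDiffOn ℝ 1 γ (Icc 0 1) ∧ MapsTo γ (Icc 0 1) M.Θ ∧ γ 0 = θ₀ ∧ γ 1 = θ₁}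

/-- The action `∫₀¹ γ'(t)ᵀ G_W(γ(t)) γ'(t) dt` of a curve. -/
noncomputable def action (γ : ℝ → Fin d → ℝ) : ℝ :=
  ∫ t in (0 : ℝ)..1,
    M.innerW G (γ t) (derivWithin γ (Icc 0 1) t) (derivWithin γ (Icc 0 1) t)

/-- The constrained Wasserstein distance `d_W`, whose square is the infimum of the action; it is `∞`
if no `C¹` curve in `Θ` joins the two points. -/
noncomputable def distW (θ₀ θ₁ : Fin d → ℝ) : ℝ≥0∞ :=
  (⨅ γ ∈ M.curves θ₀ θ₁, ENNReal.ofReal (M.action G γ)) ^ (1 / 2 : ℝ)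

/-- `γ` is a constant speed geodesic of `(Θ, d_W)`, parametrized on `[0,1]`, from `θ₀` to `θ₁`. -/
structure IsConstSpeedGeodesic (γ : ℝ → Fin d → ℝ) (θ₀ θ₁ : Fin d → ℝ) : Prop where
  mapsTo : MapsTo γ (Icc 0 1) M.Θ
  source : γ 0 = θ₀
  target : γ 1 = θ₁
  dist_ne_top : M.distW G θ₀ θ₁ ≠ ∞
  dist_eq : ∀ s ∈ Icc (0 : ℝ) 1, ∀ t ∈ Icc (0 : ℝ) 1,
    M.distW G (γ s) (γ t) = ENNReal.ofReal |s - t| * M.distW G θ₀ θ₁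

/-- The Kullback-Leibler divergence `D_KL(p(θ) ‖ q)`. -/
noncomputable def klDiv (q : Fin n → ℝ) (θ : Fin d → ℝ) : ℝ :=
  ∑ i, M.p θ i * Real.log (M.p θ i / q i)

/-- `Ric(Θ, I, p) ≥ κ`: the KL divergence is `κ`-convex along all constant speed geodesics. -/
def RicciLowerBound (q : Fin n → ℝ) (κ : ℝ) : Prop :=
  ∀ (θ₀ θ₁ : Fin d → ℝ) (γ : ℝ → Fin d → ℝ), M.IsConstSpeedGeodesic G γ θ₀ θ₁ →
    ∀ t ∈ Icc (0 : ℝ) 1,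
      M.klDiv q (γ t) ≤ (1 - t) * M.klDiv q θ₀ + t * M.klDiv q θ₁
        - κ / 2 * t * (1 - t) * (M.distW G θ₀ θ₁).toReal ^ 2

/-- The Wasserstein gradient `grad_W D_KL = G_W† ∇_θ D_KL(p(θ) ‖ q)`. -/
noncomputable def gradKL (q : Fin n → ℝ) (θ : Fin d → ℝ) : Fin d → ℝ :=
  pinv (M.metricW G θ) *ᵥ fun j => fderivWithin ℝ (M.klDiv q) M.Θ θ (Pi.single j 1)

/-- The relative Fisher information `𝓘(p(θ) ‖ q) = g_W(grad_W D_KL, grad_W D_KL)`. -/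
noncomputable def fisherInfo (q : Fin n → ℝ) (θ : Fin d → ℝ) : ℝ :=
  M.innerW G θ (M.gradKL G q θ) (M.gradKL G q θ)

end StatModel

/-!
For `θ` in `Θ`, evaluate the convexity inequality along a constant speed geodesic from `θ` to the
minimizer `θ*`. Talagrand's inequality follows from `KL(θ*) ≤ KL(θ_t)` by dividing by `1 - t` and
letting `t → 1` (`StatModel.RicciLowerBound.mul_distW_sq_le`). For the other two, divide by `t` and
let `t → 0`: what is needed is that the descending slope of `KL` at `θ` with respect to `d_W` is at
most `√𝓘(θ)`.

The slope bound (`StatModel.exists_sub_le_of_distW`) comes from near-optimal curves. Along a curve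
`γ`, Young's inequality for the dual pair of norms `g_W`, `g_W⁻¹` bounds `-(KL ∘ γ)'` by
`s / 2 * 𝓘(γ) + 1 / (2 * s) * g_W(γ', γ')`, whose integral contains the action directly
(`StatModel.sub_le_of_mem_curves`). This form avoids square roots of the metric; with `s` proportional
to the distance it becomes a family of linear bounds indexed by `σ > 0`
(`StatModel.RicciLowerBound.klDiv_sub_le`). The choice `σ = 1 / κ` is log-Sobolev, and the infimum
over `σ` is HWI.

Two facts make the estimate local at `θ`. The metric is positive definite and continuous on `Θ`:
by connectedness of the graph, the Laplacian plus the all-ones matrix is positive definite, and its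
inverse coincides with the pseudo-inverse of the Laplacian on the columns of the Jacobi matrix, which
have zero sum since `p` takes values in the simplex (`WeightedGraph.pinv_laplacian_mul`,
`StatModel.metricW_posDef`). Therefore a curve of small action cannot leave a neighbourhood of its
starting point (`StatModel.exists_action_lt_imp_dist_lt`), which is the estimate along curves applied
to the coordinate functions up to the first exit time.
-/

/-! ### Linear algebra -/

theorem pinv_eq_inv {m : ℕ} {A : Matrix (Fin m) (Fin m) ℝ} (hA : IsUnit A) : pinv A = A⁻¹ := by
  have hdet := (Matrix.isUnit_iff_isUnit_det A).1 hA
  refine (pinv_spec A).unique ⟨?_, ?_, ?_, ?_⟩ <;>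
    simp [Matrix.mul_nonsing_inv A hdet, Matrix.nonsing_inv_mul A hdet]

/-- Young's inequality for the dual pair of norms given by a positive definite matrix `A`. -/
theorem Matrix.PosDef.dotProduct_le_add {m : ℕ} {A : Matrix (Fin m) (Fin m) ℝ} (hA : A.PosDef)
    (b v : Fin m → ℝ) {s : ℝ} (hs : 0 < s) :
    b ⬝ᵥ v ≤ s / 2 * (b ⬝ᵥ A⁻¹ *ᵥ b) + 1 / (2 * s) * (v ⬝ᵥ A *ᵥ v) := by
  have hdet := (Matrix.isUnit_iff_isUnit_det A).1 hA.isUnit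
  obtain ⟨a, ha⟩ : ∃ a, a = A⁻¹ *ᵥ b := ⟨_, rfl⟩
  have hb : A *ᵥ a = b := by
    rw [ha, mulVec_mulVec, Matrix.mul_nonsing_inv A hdet, one_mulVec]
  have hsymm : Aᵀ = A := by simpa using hA.isHermitian.eq
  have h1 : a ⬝ᵥ A *ᵥ v = b ⬝ᵥ v := by
    rw [dotProduct_mulVec, ← mulVec_transpose, hsymm, hb]
  have h2 : v ⬝ᵥ A *ᵥ a = b ⬝ᵥ v := by rw [hb, dotProduct_comm]
  have h0 : 0 ≤ (v - s • a) ⬝ᵥ A *ᵥ (v - s • a) := by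
    simpa using hA.posSemidef.dotProduct_mulVec_nonneg (v - s • a)
  have h3 : (v - s • a) ⬝ᵥ A *ᵥ (v - s • a)
      = v ⬝ᵥ A *ᵥ v - 2 * s * (b ⬝ᵥ v) + s ^ 2 * (b ⬝ᵥ a) := by
    simp only [mulVec_sub, mulVec_smul, sub_dotProduct, dotProduct_sub, smul_dotProduct,
      dotProduct_smul, h1, h2, smul_eq_mul]
    rw [hb, dotProduct_comm a b]
    ring
  rw [h3] at h0
  rw [← ha]
  have h4 : s / 2 * (b ⬝ᵥ a) + 1 / (2 * s) * (v ⬝ᵥ A *ᵥ v) - b ⬝ᵥ v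
      = (v ⬝ᵥ A *ᵥ v - 2 * s * (b ⬝ᵥ v) + s ^ 2 * (b ⬝ᵥ a)) / (2 * s) := by
    field_simp
    ring
  have h5 := div_nonneg h0 (by positivity : 0 ≤ 2 * s)
  linarith

namespace WeightedGraph

variable {n : ℕ} (G : WeightedGraph n)

/-! ### The weighted Laplacian -/

theorem weight_nonneg (i j : Fin n) : 0 ≤ G.weight i j := by
  by_cases h : G.graph.Adj i j
  · exact (G.weight_pos i j h).le
  · exact (G.weight_zero i j h).ge

theorem vol_pos_of_adj {i j : Fin n} (h : G.graph.Adj i j) : 0 < G.vol i := by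
  have hi : 0 < ∑ j, G.weight i j :=
    Finset.sum_pos' (fun k _ => G.weight_nonneg i k) ⟨j, Finset.mem_univ _, G.weight_pos i j h⟩
  exact div_pos hi (Finset.sum_pos' (fun k _ => Finset.sum_nonneg fun l _ => G.weight_nonneg k l)
    ⟨i, Finset.mem_univ _, hi⟩)

theorem edgeWeight_posDef {x : Fin n → ℝ} (hx : ∀ i, 0 < x i) : (G.edgeWeight x).PosDef := by
  refine Matrix.PosDef.diagonal fun e => ?_
  have h1 := G.vol_pos_of_adj e.2.1
  have h2 := G.vol_pos_of_adj e.2.1.symm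
  have := hx e.1.1
  have := hx e.1.2
  positivity

theorem discreteGrad_mulVec (y : Fin n → ℝ) (e : G.Edge) :
    (G.discreteGrad *ᵥ y) e = √(G.weight e.1.1 e.1.2) * (y e.1.1 - y e.1.2) := by
  have hne : e.1.1 ≠ e.1.2 := e.2.1.ne
  have h : ∀ k, G.discreteGrad e k * y k
      = (if k = e.1.1 then √(G.weight e.1.1 e.1.2) * y k else 0)
        - (if k = e.1.2 then √(G.weight e.1.1 e.1.2) * y k else 0) := by
    intro k
    simp only [discreteGrad, of_apply]
    split_ifs with h1 h2
    · exact absurd (h1.symm.trans h2) hne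
    all_goals ring
  simp only [mulVec, dotProduct, h, Finset.sum_sub_distrib, Finset.sum_ite_eq', Finset.mem_univ,
    if_true]
  ring

theorem eq_of_discreteGrad_mulVec_eq_zero {y : Fin n → ℝ} (hy : G.discreteGrad *ᵥ y = 0)
    (i j : Fin n) : y i = y j := by
  have hadj : ∀ i j, G.graph.Adj i j → j < i → y i = y j := by
    intro i j h hlt
    have h1 := congrFun hy ⟨(i, j), h, hlt⟩
    rw [discreteGrad_mulVec] at h1
    have h2 : √(G.weight i j) ≠ 0 := (Real.sqrt_pos.2 (G.weight_pos i j h)).ne'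
    exact sub_eq_zero.1 ((mul_eq_zero.1 h1).resolve_left h2)
  obtain ⟨w⟩ := G.connected.preconnected i j
  induction w with
  | nil => rfl
  | cons h _ ih =>
    refine Eq.trans ?_ ih
    rcases lt_or_gt_of_ne h.ne with hlt | hlt
    · exact (hadj _ _ h.symm hlt).symm
    · exact hadj _ _ h hlt

/-- The Laplacian plus the all-ones matrix. By connectedness it is invertible, and its inverse agrees
with the pseudo-inverse of the Laplacian on vectors of zero sum, so it replaces the pseudo-inverse by
an expression that is visibly continuous in `x`. -/
noncomputable def regLaplacian (x : Fin n → ℝ) : Matrix (Fin n) (Fin n) ℝ :=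
  G.laplacian x + Matrix.of fun _ _ => 1

theorem laplacian_posSemidef {x : Fin n → ℝ} (hx : ∀ i, 0 < x i) : (G.laplacian x).PosSemidef := by
  simpa [laplacian] using
    (G.edgeWeight_posDef hx).posSemidef.conjTranspose_mul_mul_same G.discreteGrad

theorem regLaplacian_posDef {x : Fin n → ℝ} (hx : ∀ i, 0 < x i) : (G.regLaplacian x).PosDef := by
  have hones : (Matrix.of fun _ _ => 1 : Matrix (Fin n) (Fin n) ℝ).IsHermitian := by
    ext; simp
  refine Matrix.PosDef.of_dotProduct_mulVec_pos ((G.laplacian_posSemidef hx).isHermitian.add hones)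
    fun y hy => ?_
  have hL : star y ⬝ᵥ (G.laplacian x *ᵥ y)
      = (G.discreteGrad *ᵥ y) ⬝ᵥ (G.edgeWeight x *ᵥ (G.discreteGrad *ᵥ y)) := by
    simp only [laplacian, ← mulVec_mulVec, star_trivial]
    rw [dotProduct_mulVec, vecMul_transpose]
  have hE : star y ⬝ᵥ ((Matrix.of fun _ _ => 1 : Matrix (Fin n) (Fin n) ℝ) *ᵥ y)
      = (∑ i, y i) ^ 2 := by
    simp [dotProduct, mulVec, ← Finset.sum_mul, sq]
  rw [regLaplacian, add_mulVec, dotProduct_add, hL, hE]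
  by_cases h : G.discreteGrad *ᵥ y = 0
  · have hc := G.eq_of_discreteGrad_mulVec_eq_zero h
    obtain ⟨i, hi⟩ := Function.ne_iff.1 hy
    have hsum : ∑ j, y j = n * y i := by
      rw [Finset.sum_congr rfl fun j _ => hc j i]
      simp
    have hn : (n : ℝ) ≠ 0 := Nat.cast_ne_zero.2 (Fin.pos i).ne'
    have : ∑ j, y j ≠ 0 := by
      rw [hsum]
      exact mul_ne_zero hn hi
    rw [h]
    simp only [zero_dotProduct, zero_add]
    positivity
  · have := (G.edgeWeight_posDef hx).dotProduct_mulVec_pos h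
    rw [star_trivial] at this
    positivity

theorem laplacian_mul_ones (x : Fin n → ℝ) {k : Type*} :
    G.laplacian x * (Matrix.of fun _ _ => 1 : Matrix (Fin n) k ℝ) = 0 := by
  have h : G.discreteGrad * (Matrix.of fun _ _ => 1 : Matrix (Fin n) k ℝ) = 0 := by
    ext e j
    have := G.discreteGrad_mulVec (fun _ => 1) e
    simpa [mulVec, dotProduct, Matrix.mul_apply] using this
  rw [laplacian, Matrix.mul_assoc, h, Matrix.mul_zero]

/-- On matrices whose columns have zero sum, the pseudo-inverse of the Laplacian acts as the inverse
of `regLaplacian`. -/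
theorem pinv_laplacian_mul {x : Fin n → ℝ} (hx : ∀ i, 0 < x i) {d : ℕ} {J : Matrix (Fin n) (Fin d) ℝ}
    (hJ : ∀ j, ∑ i, J i j = 0) : pinv (G.laplacian x) * J = (G.regLaplacian x)⁻¹ * J := by
  have hdet := (Matrix.isUnit_iff_isUnit_det _).1 (G.regLaplacian_posDef hx).isUnit
  have hLt : (G.laplacian x)ᵀ = G.laplacian x := by
    simpa using (G.laplacian_posSemidef hx).isHermitian.eq
  have hLE := G.laplacian_mul_ones x (k := Fin n)
  have hreg : G.regLaplacian x = G.laplacian x + Matrix.of fun _ _ => 1 := rfl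
  have hP := pinv_spec (G.laplacian x)
  obtain ⟨L, hL⟩ : ∃ L, L = G.laplacian x := ⟨_, rfl⟩
  obtain ⟨P, hPdef⟩ : ∃ P, P = pinv L := ⟨_, rfl⟩
  obtain ⟨E, hEdef⟩ : ∃ E : Matrix (Fin n) (Fin n) ℝ, E = Matrix.of fun _ _ => 1 := ⟨_, rfl⟩
  have hEt : Eᵀ = E := by rw [hEdef]; ext; simp
  have hEJ : E * J = 0 := by
    ext i j
    simp [hEdef, Matrix.mul_apply, hJ]
  rw [← hL, ← hPdef] at hP
  rw [← hL] at hLt hreg hLE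
  rw [← hEdef] at hreg hLE
  rw [← hL, ← hPdef]
  have hEL : E * L = 0 := by
    have := congrArg transpose hLE
    rwa [transpose_mul, hLt, hEt, transpose_zero] at this
  have hEP : E * P = 0 := by
    calc E * P = E * (P * L) * P := by rw [Matrix.mul_assoc, hP.mul_mul_right]
      _ = E * (L * Pᵀ) * P := by rw [← hP.symm_right, transpose_mul, hLt]
      _ = 0 := by rw [← Matrix.mul_assoc, hEL, Matrix.zero_mul, Matrix.zero_mul]
  have hLLP : L * (L * P) = L := by
    calc L * (L * P) = Lᵀ * (L * P)ᵀ := by rw [hLt, hP.symm_left]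
      _ = L := by rw [← transpose_mul, hP.mul_mul_left, hLt]
  have hW : G.regLaplacian x * (J - L * P * J) = 0 := by
    rw [hreg, Matrix.mul_sub, Matrix.add_mul, Matrix.add_mul, hEJ, ← Matrix.mul_assoc L,
      ← Matrix.mul_assoc E, ← Matrix.mul_assoc E, hLLP, hEL]
    simp
  have hJ' : J = L * P * J := by
    refine sub_eq_zero.1 ?_
    rw [← Matrix.nonsing_inv_mul_cancel_left (A := G.regLaplacian x) (J - L * P * J) hdet, hW,
      Matrix.mul_zero]
  have hRP : G.regLaplacian x * (P * J) = J := by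
    rw [hreg, ← Matrix.mul_assoc, Matrix.add_mul, hEP, add_zero]
    exact hJ'.symm
  rw [← Matrix.nonsing_inv_mul_cancel_left (A := G.regLaplacian x) (P * J) hdet, hRP]

theorem continuous_regLaplacian : Continuous G.regLaplacian := by
  unfold regLaplacian laplacian edgeWeight
  fun_prop

end WeightedGraph

/-! ### Rank and inversion of matrices -/

theorem Matrix.mulVec_injective_of_rank_eq {n d : ℕ} {J : Matrix (Fin n) (Fin d) ℝ}
    (h : J.rank = d) : Function.Injective J.mulVec := by
  have h1 := LinearMap.finrank_range_add_finrank_ker J.mulVecLin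
  have h2 : Module.finrank ℝ (LinearMap.range J.mulVecLin) = d := h
  rw [h2, Module.finrank_fin_fun] at h1
  have h3 : LinearMap.ker J.mulVecLin = ⊥ := Submodule.finrank_eq_zero.1 (by omega)
  exact LinearMap.ker_eq_bot.1 h3

/-- On a set where all values are invertible, inversion preserves continuity of a matrix-valued
function. -/
theorem ContinuousOn.matrix_nonsing_inv {α : Type*} [TopologicalSpace α] {m : ℕ}
    {A : α → Matrix (Fin m) (Fin m) ℝ} {s : Set α} (hA : ContinuousOn A s)
    (hu : ∀ x ∈ s, IsUnit (A x)) : ContinuousOn (fun x => (A x)⁻¹) s := by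
  intro x hx
  have hdet := (Matrix.isUnit_iff_isUnit_det _).1 (hu x hx)
  refine (continuousAt_matrix_inv (A x) ?_).comp_continuousWithinAt (hA x hx)
  rw [Ring.inverse_eq_inv']
  exact continuousAt_inv₀ hdet.ne_zero

namespace StatModel

variable {n d : ℕ} (M : StatModel n d) (G : WeightedGraph n)

/-! ### The metric tensor -/

theorem hasFDerivWithinAt_p {θ : Fin d → ℝ} (hθ : θ ∈ M.Θ) :
    HasFDerivWithinAt M.p (fderivWithin ℝ M.p M.Θ θ) M.Θ θ :=
  (M.contDiffOn.differentiableOn one_ne_zero θ hθ).hasFDerivWithinAt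

theorem continuousOn_jacobian : ContinuousOn (jacobian M.Θ M.p) M.Θ := by
  have h := M.contDiffOn.continuousOn_fderivWithin M.uniqueDiffOn le_rfl
  refine continuousOn_pi.2 fun i => continuousOn_pi.2 fun j => ?_
  exact (continuous_apply i).comp_continuousOn (h.clm_apply continuousOn_const)

theorem sum_jacobian {θ : Fin d → ℝ} (hθ : θ ∈ M.Θ) (j : Fin d) :
    ∑ i, jacobian M.Θ M.p θ i j = 0 := by
  have h1 : HasFDerivWithinAt (fun θ => ∑ i, M.p θ i)
      (∑ i, (ContinuousLinearMap.proj i).comp (fderivWithin ℝ M.p M.Θ θ)) M.Θ θ :=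
    HasFDerivWithinAt.fun_sum fun i _ => hasFDerivWithinAt_pi'.1 (M.hasFDerivWithinAt_p hθ) i
  have h2 : HasFDerivWithinAt (fun θ => ∑ i, M.p θ i) (0 : (Fin d → ℝ) →L[ℝ] ℝ) M.Θ θ :=
    (hasFDerivWithinAt_const (1 : ℝ) θ M.Θ).congr (fun x hx => (M.mem_posSimplex x hx).2)
      (M.mem_posSimplex θ hθ).2
  have h3 := congrArg (fun l : (Fin d → ℝ) →L[ℝ] ℝ => l (Pi.single j 1))
    ((M.uniqueDiffOn θ hθ).eq h1 h2)
  simpa [jacobian] using h3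

theorem metricW_eq {θ : Fin d → ℝ} (hθ : θ ∈ M.Θ) :
    M.metricW G θ = (jacobian M.Θ M.p θ)ᵀ * (G.regLaplacian (M.p θ))⁻¹ * jacobian M.Θ M.p θ := by
  rw [metricW, Matrix.mul_assoc,
    G.pinv_laplacian_mul (M.mem_posSimplex θ hθ).1 (M.sum_jacobian hθ), ← Matrix.mul_assoc]

theorem metricW_posDef {θ : Fin d → ℝ} (hθ : θ ∈ M.Θ) : (M.metricW G θ).PosDef := by
  rw [M.metricW_eq G hθ]
  simpa using (G.regLaplacian_posDef (M.mem_posSimplex θ hθ).1).inv.conjTranspose_mul_mul_same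
    (Matrix.mulVec_injective_of_rank_eq (M.rank_jacobian θ hθ))

theorem innerW_self_nonneg {θ : Fin d → ℝ} (hθ : θ ∈ M.Θ) (v : Fin d → ℝ) :
    0 ≤ M.innerW G θ v v := by
  simpa [innerW] using (M.metricW_posDef G hθ).posSemidef.dotProduct_mulVec_nonneg v

theorem continuousOn_metricW : ContinuousOn (M.metricW G) M.Θ := by
  have hJ := M.continuousOn_jacobian
  have hL : ContinuousOn (fun θ => (G.regLaplacian (M.p θ))⁻¹) M.Θ :=
    ContinuousOn.matrix_nonsing_inv
      (G.continuous_regLaplacian.comp_continuousOn M.contDiffOn.continuousOn)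
      fun θ hθ => (G.regLaplacian_posDef (M.mem_posSimplex θ hθ).1).isUnit
  refine ContinuousOn.congr ?_ fun θ hθ => M.metricW_eq G hθ
  rw [continuousOn_iff_continuous_domRestrict] at *
  exact (hJ.matrix_transpose.matrix_mul hL).matrix_mul hJ

/-- The squared norm of the covector `b` at `θ`, dual to the metric `g^W_θ`. -/
noncomputable def conormSq (θ b : Fin d → ℝ) : ℝ :=
  b ⬝ᵥ (M.metricW G θ)⁻¹ *ᵥ b

theorem conormSq_nonneg {θ : Fin d → ℝ} (hθ : θ ∈ M.Θ) (b : Fin d → ℝ) :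
    0 ≤ M.conormSq G θ b := by
  simpa [conormSq] using (M.metricW_posDef G hθ).inv.posSemidef.dotProduct_mulVec_nonneg b

theorem continuousOn_conormSq {b : (Fin d → ℝ) → Fin d → ℝ} (hb : ContinuousOn b M.Θ) :
    ContinuousOn (fun θ => M.conormSq G θ (b θ)) M.Θ := by
  have h := (M.continuousOn_metricW G).matrix_nonsing_inv fun θ hθ => (M.metricW_posDef G hθ).isUnit
  rw [continuousOn_iff_continuous_domRestrict] at *
  exact hb.dotProduct (h.matrix_mulVec hb)

/-- The coordinate vector of the derivative within `Θ` of a real function on `Θ`. -/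
noncomputable def dualGrad (h : (Fin d → ℝ) → ℝ) (θ : Fin d → ℝ) : Fin d → ℝ :=
  fun j => fderivWithin ℝ h M.Θ θ (Pi.single j 1)

theorem fderivWithin_eq_dualGrad_dotProduct (h : (Fin d → ℝ) → ℝ) (θ v : Fin d → ℝ) :
    fderivWithin ℝ h M.Θ θ v = M.dualGrad h θ ⬝ᵥ v := by
  conv_lhs => rw [pi_eq_sum_univ' v]
  simp [dualGrad, dotProduct, mul_comm]

theorem continuousOn_dualGrad {h : (Fin d → ℝ) → ℝ} (hh : ContDiffOn ℝ 1 h M.Θ) :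
    ContinuousOn (M.dualGrad h) M.Θ :=
  continuousOn_pi.2 fun _ =>
    (hh.continuousOn_fderivWithin M.uniqueDiffOn le_rfl).clm_apply continuousOn_const

theorem fisherInfo_eq_conormSq (q : Fin n → ℝ) {θ : Fin d → ℝ} (hθ : θ ∈ M.Θ) :
    M.fisherInfo G q θ = M.conormSq G θ (M.dualGrad (M.klDiv q) θ) := by
  have hu := (M.metricW_posDef G hθ).isUnit
  have hdet := (Matrix.isUnit_iff_isUnit_det _).1 hu
  rw [fisherInfo, innerW, gradKL, pinv_eq_inv hu, mulVec_mulVec, Matrix.mul_nonsing_inv _ hdet,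
    one_mulVec, dotProduct_comm]
  rfl

theorem contDiffOn_klDiv {q : Fin n → ℝ} (hq : q ∈ posSimplex n) :
    ContDiffOn ℝ 1 (M.klDiv q) M.Θ := by
  have hp := contDiffOn_pi.1 M.contDiffOn
  refine ContDiffOn.sum fun i _ => (hp i).mul (((hp i).div_const _).log fun θ hθ => ?_)
  exact (div_pos ((M.mem_posSimplex θ hθ).1 i) (hq.1 i)).ne'

/-! ### Estimates along curves -/

theorem continuousOn_action_integrand {θ θ' : Fin d → ℝ} {γ : ℝ → Fin d → ℝ}
    (hγ : γ ∈ M.curves θ θ') :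
    ContinuousOn (fun t => M.innerW G (γ t) (derivWithin γ (Icc 0 1) t) (derivWithin γ (Icc 0 1) t))
      (Icc 0 1) := by
  have h1 := hγ.1.continuousOn_derivWithin uniqueDiffOn_Icc_zero_one le_rfl
  have h2 := (M.continuousOn_metricW G).comp hγ.1.continuousOn hγ.2.1
  rw [continuousOn_iff_continuous_domRestrict] at *
  exact h1.dotProduct (h2.matrix_mulVec h1)

/-- A `C¹` function grows along a curve at most as dictated by a bound `C` on the squared dual norm
of its derivative and by the action of the curve. -/
theorem sub_le_of_mem_curves {θ θ' : Fin d → ℝ} {γ : ℝ → Fin d → ℝ}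
    (hγ : γ ∈ M.curves θ θ') {h : (Fin d → ℝ) → ℝ} (hh : ContDiffOn ℝ 1 h M.Θ) {τ : ℝ}
    (hτ : τ ∈ Icc (0 : ℝ) 1) {C : ℝ} (hC : 0 ≤ C)
    (hb : ∀ t ∈ Ioo 0 τ, M.conormSq G (γ t) (M.dualGrad h (γ t)) ≤ C) {s : ℝ} (hs : 0 < s) :
    h (γ τ) - h θ ≤ s / 2 * C + 1 / (2 * s) * M.action G γ := by
  have hsub : Icc 0 τ ⊆ Icc (0 : ℝ) 1 := Icc_subset_Icc_right hτ.2
  obtain ⟨g, hg⟩ : ∃ g : ℝ → ℝ, g = fun t =>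
    M.innerW G (γ t) (derivWithin γ (Icc 0 1) t) (derivWithin γ (Icc 0 1) t) := ⟨_, rfl⟩
  have hgc : ContinuousOn g (Icc 0 1) := hg ▸ M.continuousOn_action_integrand G hγ
  have hg0 : ∀ t ∈ Icc (0 : ℝ) 1, 0 ≤ g t := fun t ht => by
    rw [hg]; exact M.innerW_self_nonneg G (hγ.2.1 ht) _
  have hint : IntervalIntegrable g MeasureTheory.volume 0 1 :=
    ContinuousOn.intervalIntegrable (by rwa [uIcc_of_le zero_le_one])
  have hint' : IntervalIntegrable g MeasureTheory.volume 0 τ :=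
    ContinuousOn.intervalIntegrable (by rw [uIcc_of_le hτ.1]; exact hgc.mono hsub)
  have hcont : ContinuousOn (fun t => h (γ t)) (Icc 0 τ) :=
    (hh.continuousOn.comp hγ.1.continuousOn hγ.2.1).mono hsub
  have key := intervalIntegral.sub_le_integral_of_hasDeriv_right_of_le (g := fun t => h (γ t))
    (g' := fun t => M.dualGrad h (γ t) ⬝ᵥ derivWithin γ (Icc 0 1) t)
    (φ := fun t => s / 2 * C + 1 / (2 * s) * g t) hτ.1 hcont ?_ ?_ ?_
  · rw [intervalIntegral.integral_add (by simp) (hint'.const_mul _),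
      intervalIntegral.integral_const, intervalIntegral.integral_const_mul, hγ.2.2.1] at key
    have hact : ∫ t in (0 : ℝ)..τ, g t ≤ M.action G γ := by
      have : M.action G γ = ∫ t in (0 : ℝ)..1, g t := by rw [hg]; rfl
      rw [this]
      refine intervalIntegral.integral_mono_interval le_rfl hτ.1 hτ.2 ?_ hint
      filter_upwards [MeasureTheory.ae_restrict_mem measurableSet_Ioc] with t ht
      exact hg0 t (Ioc_subset_Icc_self ht)
    have h1 : (τ - 0) • (s / 2 * C) ≤ s / 2 * C := by
      rw [sub_zero, smul_eq_mul]
      exact mul_le_of_le_one_left (by positivity) hτ.2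
    have h2 := mul_le_mul_of_nonneg_left hact (by positivity : 0 ≤ 1 / (2 * s))
    linarith
  · intro t ht
    have ht1 : t ∈ Ioo (0 : ℝ) 1 := ⟨ht.1, ht.2.trans_le hτ.2⟩
    have ht' : t ∈ Icc (0 : ℝ) 1 := Ioo_subset_Icc_self ht1
    have hγd : HasDerivWithinAt γ (derivWithin γ (Icc 0 1) t) (Icc 0 1) t :=
      (hγ.1.differentiableOn one_ne_zero t ht').hasDerivWithinAt
    have hhd := (hh.differentiableOn one_ne_zero (γ t) (hγ.2.1 ht')).hasFDerivWithinAt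
    have := hhd.comp_hasDerivWithinAt t hγd hγ.2.1
    rw [fderivWithin_eq_dualGrad_dotProduct] at this
    exact this.mono_of_mem_nhdsWithin (Icc_mem_nhdsGT_of_mem (Ioo_subset_Ico_self ht1))
  · exact (continuousOn_const.add (continuousOn_const.mul (hgc.mono hsub))).integrableOn_Icc
  · intro t ht
    have ht' : t ∈ Icc (0 : ℝ) 1 := ⟨ht.1.le, (ht.2.trans_le hτ.2).le⟩
    have h1 := (M.metricW_posDef G (hγ.2.1 ht')).dotProduct_le_add (M.dualGrad h (γ t))
      (derivWithin γ (Icc 0 1) t) hs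
    have h2 := mul_le_mul_of_nonneg_left (hb t ht) (by positivity : 0 ≤ s / 2)
    rw [hg]
    exact h1.trans (add_le_add_left h2 _)

open scoped Topology in
/-- Curves of small action stay close to their starting point. -/
theorem exists_action_lt_imp_dist_lt {θ : Fin d → ℝ} (hθ : θ ∈ M.Θ) {r : ℝ} (hr : 0 < r) :
    ∃ η > 0, ∀ θ', ∀ γ ∈ M.curves θ θ', M.action G γ < η →
      ∀ t ∈ Icc (0 : ℝ) 1, dist (γ t) θ < r := by
  obtain ⟨C, hCdef⟩ : ∃ C, C = ∑ j, (M.conormSq G θ (Pi.single j 1) + 1) := ⟨_, rfl⟩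
  have hpos : ∀ j ∈ Finset.univ, 0 ≤ M.conormSq G θ (Pi.single j 1) + 1 := fun j _ =>
    add_nonneg (M.conormSq_nonneg G hθ _) zero_le_one
  have hC : 0 ≤ C := hCdef ▸ Finset.sum_nonneg hpos
  have hev : ∀ᶠ x in 𝓝[M.Θ] θ, ∀ j, M.conormSq G x (Pi.single j 1) < C + 1 := by
    refine Filter.eventually_all.2 fun j => ?_
    have h1 := M.continuousOn_conormSq G (b := fun _ => Pi.single j 1) continuousOn_const θ hθ
    refine h1.eventually_lt_const ?_
    have := Finset.single_le_sum hpos (Finset.mem_univ j)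
    linarith
  obtain ⟨δ, hδ, hball⟩ := Metric.mem_nhdsWithin_iff.1 hev
  obtain ⟨ρ, hρ⟩ : ∃ ρ, ρ = min r δ := ⟨_, rfl⟩
  have hρ0 : 0 < ρ := hρ ▸ lt_min hr hδ
  have hρr : ρ ≤ r := hρ ▸ min_le_left r δ
  have hρδ : ρ ≤ δ := hρ ▸ min_le_right r δ
  -- This parameter makes both terms of the estimate along curves at most `ρ / 4`.
  obtain ⟨s, hs⟩ : ∃ s, s = ρ / (2 * (C + 1)) := ⟨_, rfl⟩
  have hs0 : 0 < s := by rw [hs]; positivity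
  refine ⟨s * ρ / 2, by positivity, fun θ' γ hγ hact t ht => ?_⟩
  by_contra hcon
  have hK : IsCompact (Icc (0 : ℝ) 1 ∩ (fun t => dist (γ t) θ) ⁻¹' Ici ρ) :=
    isCompact_Icc.of_isClosed_subset
      (ContinuousOn.preimage_isClosed_of_isClosed
        (continuous_id.dist continuous_const |>.comp_continuousOn hγ.1.continuousOn)
        isClosed_Icc isClosed_Ici) inter_subset_left
  -- The first time at which the curve leaves the ball of radius `ρ`.
  obtain ⟨τ, ⟨hτ, hτρ⟩, hleast⟩ := hK.exists_isLeast ⟨t, ht, hρr.trans (not_lt.1 hcon)⟩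
  refine absurd hτρ (not_le.2 ((dist_pi_lt_iff hρ0).2 fun j => ?_))
  have hbound : ∀ ε : ℝ, ε ^ 2 = 1 → ε * (γ τ j - θ j) < ρ := by
    intro ε hε
    obtain ⟨l, hl⟩ : ∃ l : (Fin d → ℝ) →L[ℝ] ℝ, l = ε • ContinuousLinearMap.proj j := ⟨_, rfl⟩
    have hgrad : ∀ x ∈ M.Θ, M.dualGrad l x = ε • Pi.single j 1 := by
      intro x hx
      ext k
      rw [dualGrad, l.fderivWithin (M.uniqueDiffOn x hx), hl]
      simp [Pi.single_apply, eq_comm]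
    have key := M.sub_le_of_mem_curves G hγ (h := l) l.contDiff.contDiffOn hτ
      (C := C + 1) (by positivity) (fun t ht => ?_) hs0
    · have h1 : s / 2 * (C + 1) = ρ / 4 := by
        rw [hs]
        field_simp
        ring
      have h2 : 1 / (2 * s) * M.action G γ ≤ 1 / (2 * s) * (s * ρ / 2) :=
        mul_le_mul_of_nonneg_left hact.le (by positivity)
      have h3 : 1 / (2 * s) * (s * ρ / 2) = ρ / 4 := by
        field_simp
        ring
      have h4 : l (γ τ) - l θ = ε * (γ τ j - θ j) := by
        rw [hl]
        simp [mul_sub]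
      linarith
    · have ht' : t ∈ Icc (0 : ℝ) 1 := ⟨ht.1.le, ht.2.le.trans hτ.2⟩
      have hmem := hγ.2.1 ht'
      have hlt : dist (γ t) θ < ρ := by
        by_contra h
        exact absurd (hleast ⟨ht', not_lt.1 h⟩) (not_le.2 ht.2)
      have h5 : M.conormSq G (γ t) (Pi.single j 1) < C + 1 :=
        hball ⟨Metric.mem_ball.2 (hlt.trans_le hρδ), hmem⟩ j
      have h6 : M.conormSq G (γ t) (ε • Pi.single j 1)
          = ε ^ 2 * M.conormSq G (γ t) (Pi.single j 1) := by
        simp only [conormSq, mulVec_smul, smul_dotProduct, dotProduct_smul, smul_eq_mul]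
        ring
      rw [hgrad _ hmem, h6, hε, one_mul]
      exact h5.le
  rw [Real.dist_eq, abs_lt]
  have h1 := hbound 1 (by norm_num)
  have h2 := hbound (-1) (by norm_num)
  constructor <;> linarith

theorem exists_curve_of_distW_lt {θ θ' : Fin d → ℝ} {D a : ℝ} (hD : 0 ≤ D)
    (hdist : M.distW G θ θ' = ENNReal.ofReal D) (ha : D ^ 2 < a) :
    ∃ γ ∈ M.curves θ θ', M.action G γ < a := by
  have ha0 : 0 < a := (sq_nonneg D).trans_lt ha
  have h1 : M.distW G θ θ' < ENNReal.ofReal a ^ (1 / 2 : ℝ) := by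
    rw [hdist, ENNReal.ofReal_rpow_of_pos ha0, ← Real.sqrt_eq_rpow,
      ENNReal.ofReal_lt_ofReal_iff (Real.sqrt_pos.2 ha0)]
    exact (Real.lt_sqrt hD).2 ha
  rw [distW, ENNReal.rpow_lt_rpow_iff (by norm_num)] at h1
  obtain ⟨γ, hγ⟩ := iInf_lt_iff.1 h1
  obtain ⟨hmem, hlt⟩ := iInf_lt_iff.1 hγ
  exact ⟨γ, hmem, (ENNReal.ofReal_lt_ofReal_iff ha0).1 hlt⟩

/-- The descending slope of a `C¹` function at `θ` with respect to `d_W` is at most the dual norm of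
its derivative at `θ`, in the form given by Young's inequality. -/
theorem exists_sub_le_of_distW {h : (Fin d → ℝ) → ℝ} (hh : ContDiffOn ℝ 1 h M.Θ)
    {θ : Fin d → ℝ} (hθ : θ ∈ M.Θ) {ε : ℝ} (hε : 0 < ε) :
    ∃ η > 0, ∀ θ' D s, 0 ≤ D → D ^ 2 < η → 0 < s → M.distW G θ θ' = ENNReal.ofReal D →
      h θ - h θ' ≤ s / 2 * (M.conormSq G θ (M.dualGrad h θ) + ε) + 1 / (2 * s) * D ^ 2 := by
  obtain ⟨C, hCdef⟩ : ∃ C, C = M.conormSq G θ (M.dualGrad h θ) + ε := ⟨_, rfl⟩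
  have hC : 0 ≤ C := hCdef ▸ add_nonneg (M.conormSq_nonneg G hθ _) hε.le
  have hev := (M.continuousOn_conormSq G (M.continuousOn_dualGrad hh) θ hθ).eventually_lt_const
    (lt_add_of_pos_right _ hε)
  rw [← hCdef] at hev ⊢
  obtain ⟨r, hr, hball⟩ := Metric.mem_nhdsWithin_iff.1 hev
  obtain ⟨η, hη, hconf⟩ := M.exists_action_lt_imp_dist_lt G hθ hr
  refine ⟨η, hη, fun θ' D s hD hDη hs hdist => ?_⟩
  have hneg : ∀ x ∈ M.Θ, M.dualGrad (fun y => -h y) x = -M.dualGrad h x := by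
    intro x hx
    ext j
    simp [dualGrad, fderivWithin_fun_neg (M.uniqueDiffOn x hx)]
  have hcurve : ∀ a, D ^ 2 < a → a < η → h θ - h θ' ≤ s / 2 * C + 1 / (2 * s) * a := by
    intro a hDa haη
    obtain ⟨γ, hγ, hact⟩ := M.exists_curve_of_distW_lt G hD hdist hDa
    have key := M.sub_le_of_mem_curves G hγ (h := fun x => -h x) hh.neg
      (right_mem_Icc.2 zero_le_one) hC (fun t ht => ?_) hs
    · rw [hγ.2.2.2] at key
      have := mul_le_mul_of_nonneg_left hact.le (by positivity : 0 ≤ 1 / (2 * s))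
      linarith
    · have ht' := Ioo_subset_Icc_self ht
      have h1 : M.conormSq G (γ t) (M.dualGrad h (γ t)) < C :=
        hball ⟨Metric.mem_ball.2 (hconf θ' γ hγ (hact.trans haη) t ht'), hγ.2.1 ht'⟩
      rw [hneg _ (hγ.2.1 ht')]
      simpa [conormSq, mulVec_neg] using h1.le
  by_contra hcon
  have h1 : D ^ 2 < 2 * s * (h θ - h θ' - s / 2 * C) := by
    have : 2 * s * (1 / (2 * s) * D ^ 2) < 2 * s * (h θ - h θ' - s / 2 * C) :=
      mul_lt_mul_of_pos_left (by linarith) (by positivity)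
    rwa [← mul_assoc, mul_one_div_cancel (by positivity), one_mul] at this
  obtain ⟨a, hDa, ha⟩ := exists_between (lt_min h1 hDη)
  have h2 := hcurve a hDa (ha.trans_le (min_le_right _ _))
  have h3 : 1 / (2 * s) * a < 1 / (2 * s) * (2 * s * (h θ - h θ' - s / 2 * C)) :=
    mul_lt_mul_of_pos_left (ha.trans_le (min_le_left _ _)) (by positivity)
  rw [← mul_assoc, one_div_mul_cancel (by positivity), one_mul] at h3
  linarith

/-! ### Consequences of the Ricci bound -/

variable {M G}

open scoped Topology in
/-- The HWI inequality with the product `√𝓘 · d_W` replaced by its upper bound from Young's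
inequality. Taking `σ = 1 / κ` gives the log-Sobolev inequality, and optimizing in `σ` gives HWI. -/
theorem RicciLowerBound.klDiv_sub_le {q : Fin n → ℝ} {κ : ℝ} (hRic : M.RicciLowerBound G q κ)
    (hq : q ∈ posSimplex n) {θ θ' : Fin d → ℝ} (hθ : θ ∈ M.Θ) {γ : ℝ → Fin d → ℝ}
    (hγ : M.IsConstSpeedGeodesic G γ θ θ') {σ : ℝ} (hσ : 0 < σ) :
    M.klDiv q θ - M.klDiv q θ' ≤ σ / 2 * M.fisherInfo G q θ
      + 1 / (2 * σ) * (M.distW G θ θ').toReal ^ 2 - κ / 2 * (M.distW G θ θ').toReal ^ 2 := by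
  obtain ⟨D, hD⟩ : ∃ D, D = (M.distW G θ θ').toReal := ⟨_, rfl⟩
  have hD0 : 0 ≤ D := hD ▸ ENNReal.toReal_nonneg
  have hdist : M.distW G θ θ' = ENNReal.ofReal D := by
    rw [hD, ENNReal.ofReal_toReal hγ.dist_ne_top]
  rw [← hD, M.fisherInfo_eq_conormSq G q hθ]
  obtain ⟨I, hI⟩ : ∃ I, I = M.conormSq G θ (M.dualGrad (M.klDiv q) θ) := ⟨_, rfl⟩
  rw [← hI]
  have hε : ∀ ε > 0, M.klDiv q θ - M.klDiv q θ'
      ≤ σ / 2 * (I + ε) + 1 / (2 * σ) * D ^ 2 - κ / 2 * D ^ 2 := by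
    intro ε hε
    obtain ⟨η, hη, hslope⟩ := M.exists_sub_le_of_distW G (M.contDiffOn_klDiv hq) hθ hε
    rw [← hI] at hslope
    have hlim : Filter.Tendsto
        (fun t : ℝ => σ / 2 * (I + ε) + 1 / (2 * σ) * D ^ 2 - κ / 2 * (1 - t) * D ^ 2) (𝓝[>] 0)
        (𝓝 (σ / 2 * (I + ε) + 1 / (2 * σ) * D ^ 2 - κ / 2 * (1 - 0) * D ^ 2)) :=
      (Continuous.tendsto (by fun_prop) 0).mono_left nhdsWithin_le_nhds
    rw [sub_zero, mul_one] at hlim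
    refine ge_of_tendsto hlim ?_
    have hsmall : ∀ᶠ t : ℝ in 𝓝[>] 0, (t * D) ^ 2 < η := by
      have : Filter.Tendsto (fun t : ℝ => (t * D) ^ 2) (𝓝[>] 0) (𝓝 ((0 * D) ^ 2)) :=
        (Continuous.tendsto (by fun_prop) 0).mono_left nhdsWithin_le_nhds
      exact this.eventually_lt_const (by simpa using hη)
    filter_upwards [hsmall, Ioo_mem_nhdsGT (zero_lt_one' ℝ)] with t htη ht
    have ht0 : 0 < t := ht.1
    have hdt : M.distW G θ (γ t) = ENNReal.ofReal (t * D) := by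
      have := hγ.dist_eq 0 (left_mem_Icc.2 zero_le_one) t (Ioo_subset_Icc_self ht)
      rwa [hγ.source, zero_sub, abs_neg, abs_of_pos ht0, hdist, ← ENNReal.ofReal_mul ht0.le] at this
    -- Young's parameter has to scale like the distance `t * D` for the bound to be linear in `t`.
    have h1 := hslope (γ t) (t * D) (t * σ) (by positivity) htη (by positivity) hdt
    have h2 := hRic θ θ' γ hγ t (Ioo_subset_Icc_self ht)
    rw [← hD] at h2
    have h3 : 1 / (2 * (t * σ)) * (t * D) ^ 2 = t * (1 / (2 * σ) * D ^ 2) := by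
      field_simp
    rw [h3] at h1
    refine le_of_mul_le_mul_left ?_ ht0
    linarith
  refine le_of_forall_pos_le_add fun e he => ?_
  have h1 := hε (2 * e / σ) (by positivity)
  have h2 : σ / 2 * (I + 2 * e / σ) = σ / 2 * I + e := by
    field_simp
  linarith

open scoped Topology in
theorem RicciLowerBound.mul_distW_sq_le {q : Fin n → ℝ} {κ : ℝ} (hRic : M.RicciLowerBound G q κ)
    {θ θ' : Fin d → ℝ} (hmin : IsMinOn (M.klDiv q) M.Θ θ') {γ : ℝ → Fin d → ℝ}
    (hγ : M.IsConstSpeedGeodesic G γ θ θ') :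
    κ / 2 * (M.distW G θ θ').toReal ^ 2 ≤ M.klDiv q θ - M.klDiv q θ' := by
  have hlim : Filter.Tendsto (fun t : ℝ => κ / 2 * t * (M.distW G θ θ').toReal ^ 2) (𝓝[<] 1)
      (𝓝 (κ / 2 * 1 * (M.distW G θ θ').toReal ^ 2)) :=
    (Continuous.tendsto (by fun_prop) 1).mono_left nhdsWithin_le_nhds
  rw [mul_one] at hlim
  refine le_of_tendsto hlim ?_
  filter_upwards [Ioo_mem_nhdsLT (zero_lt_one' ℝ)] with t ht
  have h1 := hRic θ θ' γ hγ t (Ioo_subset_Icc_self ht)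
  have h2 : M.klDiv q θ' ≤ M.klDiv q (γ t) := hmin (hγ.mapsTo (Ioo_subset_Icc_self ht))
  refine le_of_mul_le_mul_left ?_ (sub_pos.2 ht.2)
  linarith

end StatModel

/-- A product is the infimum of the upper bounds that Young's inequality gives for it. -/
theorem le_mul_of_forall_young {X a D : ℝ} (ha : 0 ≤ a) (hD : 0 ≤ D)
    (h : ∀ σ > 0, X ≤ σ / 2 * a ^ 2 + 1 / (2 * σ) * D ^ 2) : X ≤ a * D := by
  -- The optimal `D / a` is perturbed to remain positive and finite when `a` or `D` vanishes.
  have hε : ∀ ε > 0, X ≤ (a * (D + ε) + D * (a + ε)) / 2 := by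
    intro ε hε
    have h1 := h ((D + ε) / (a + ε)) (by positivity)
    have h2 : (D + ε) / (a + ε) / 2 * a ^ 2 ≤ a * (D + ε) / 2 := by
      rw [div_div, div_mul_eq_mul_div, div_le_div_iff₀ (by positivity) two_pos]
      nlinarith [mul_nonneg (mul_nonneg ha hε.le) (add_nonneg hD hε.le)]
    have h3 : 1 / (2 * ((D + ε) / (a + ε))) * D ^ 2 ≤ D * (a + ε) / 2 := by
      have : 1 / (2 * ((D + ε) / (a + ε))) * D ^ 2 = (a + ε) * D ^ 2 / (2 * (D + ε)) := by
        field_simp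
      rw [this, div_le_div_iff₀ (by positivity) two_pos]
      nlinarith [mul_nonneg (mul_nonneg hD hε.le) (add_nonneg ha hε.le)]
    linarith
  have hlim : Filter.Tendsto (fun ε : ℝ => (a * (D + ε) + D * (a + ε)) / 2)
      (nhdsWithin 0 (Ioi 0)) (nhds ((a * (D + 0) + D * (a + 0)) / 2)) :=
    (Continuous.tendsto (by fun_prop) 0).mono_left nhdsWithin_le_nhds
  have h0 : (a * (D + 0) + D * (a + 0)) / 2 = a * D := by ring
  rw [h0] at hlim
  exact ge_of_tendsto hlim (Filter.eventually_of_mem self_mem_nhdsWithin hε)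

theorem proposition4p5 {n d : ℕ} (G : WeightedGraph n) (M : StatModel n d)
    (q : Fin n → ℝ) (hq : q ∈ posSimplex n)
    (θs : Fin d → ℝ) (hθs : θs ∈ M.Θ) (hmin : IsMinOn (M.klDiv q) M.Θ θs)
    (hgeo : ∀ θ ∈ M.Θ, ∃ γ, M.IsConstSpeedGeodesic G γ θ θs) :
    (∀ κ : ℝ, 0 < κ → M.RicciLowerBound G q κ → ∀ θ ∈ M.Θ,
      M.klDiv q θ - M.klDiv q θs ≤ 1 / (2 * κ) * M.fisherInfo G q θ) ∧
    (∀ κ : ℝ, 0 < κ → M.RicciLowerBound G q κ → ∀ θ ∈ M.Θ,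
      κ / 2 * (M.distW G θ θs).toReal ^ 2 ≤ M.klDiv q θ - M.klDiv q θs) ∧
    (∀ κ : ℝ, M.RicciLowerBound G q κ → ∀ θ ∈ M.Θ,
      M.klDiv q θ - M.klDiv q θs ≤
        √(M.fisherInfo G q θ) * (M.distW G θ θs).toReal
          - κ / 2 * (M.distW G θ θs).toReal ^ 2) := by
  refine ⟨fun κ hκ hRic θ hθ => ?_, fun κ _ hRic θ hθ => ?_, fun κ hRic θ hθ => ?_⟩
  all_goals obtain ⟨γ, hγ⟩ := hgeo θ hθ
  · have h1 := hRic.klDiv_sub_le hq hθ hγ (one_div_pos.2 hκ)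
    have h2 : 1 / (2 * (1 / κ)) = κ / 2 := by field_simp
    have h3 : 1 / κ / 2 = 1 / (2 * κ) := by field_simp
    rw [h2, h3] at h1
    linarith
  · exact hRic.mul_distW_sq_le hmin hγ
  · have hI : 0 ≤ M.fisherInfo G q θ := M.innerW_self_nonneg G hθ _
    have h1 := le_mul_of_forall_young (Real.sqrt_nonneg (M.fisherInfo G q θ))
      (ENNReal.toReal_nonneg (a := M.distW G θ θs))
      (X := M.klDiv q θ - M.klDiv q θs + κ / 2 * (M.distW G θ θs).toReal ^ 2) fun σ hσ => by
        rw [Real.sq_sqrt hI]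
        have := hRic.klDiv_sub_le hq hθ hγ hσ
        linarith
    linarith
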